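/- **Theorem 6.2.** Let $\mathbb N=\{1,2,3,\dots\}$. A *companion block* is a pair $(H,h)$ of a free $\mathbb Z$-module $H$ of finite rank $n\ge 1$ and an endomorphism $h$ of $H$ such that $a_0,h(a_0),\dots,h^{n-1}(a_0)$ is a $\mathbb Z$-basis of $H$ for some $a_0\in H$; it is an *Orlik block* if moreover $h$ is an automorphism of finite order. A *standard decomposition into Orlik blocks* of a pair $(H,h)$ is a decomposition $H=\bigoplus_{i=1}^k H^{(i)}$ into $h$-invariant sublattices such that each $(H^{(i)},h|_{H^{(i)}})$ is an Orlik block and the characteristic polynomials $p_i$ of $h|_{H^{(i)}}$ satisfy $p_k\mid p_{k-1}\mid\dots\mid p_1$. For a finite set $M\subset\mathbb N$ let $\mathrm{Or}(M)$ be the lattice $\mathbb Z[t]/(\prod_{m\in M}\Phi_m)$, where $\Phi_m$ is the $m$-th cyclotomic polynomial, with monodromy $h$ given by multiplication by $t$. For a prime $p$ let $E_p=\{(m,n)\in\mathbb N^2 : m/n=p^k \text{ for some } k\in\mathbb N\}$ (the set of $p$-edges), and for $S\subset\mathbb N$ let $E_p(S)=E_p\cap S^2$. For $\mu\in\mathbb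 N$ let $\gamma_\mu:\mathbb N\to\mathbb N$, $\gamma_\mu(m)=m/\gcd(m,\mu)$. The pair $(M,\mu)$ is called *sdiOb-sufficient* if for every prime $p$ and every $(n_a,n_b)\in E_p(\gamma_\mu(M))$ at least one of the following two conditions holds: $$E_p\cap\big((\gamma_\mu^{-1}(n_a)\cap M)\times\gamma_\mu^{-1}(n_b)\big)\subset E_p(M),$$ $$E_p\cap\big(\gamma_\mu^{-1}(n_a)\times(\gamma_\mu^{-1}(n_b)\cap M)\big)\subset E_p(M).$$ Let $M\subset\mathbb N$ be finite and non-empty, let $(H,h)=\mathrm{Or}(M)$, and let $\mu\in\mathbb N$. If $(M,\mu)$ is sdiOb-sufficient, then $(H,h^\mu)$ admits a standard decomposition into Orlik blocks. -/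

import Mathlib

open Polynomial

namespace OrlikBlocks

noncomputable section

/-! ### Lattices with endomorphism: companion blocks, Orlik blocks, standard decompositions

A `ℤ`-lattice is a finitely generated free `ℤ`-module. -/

/-- `(H, h)` is a companion block: `H` has some rank `n ≥ 1`, and there is a generating element
`a₀` such that `a₀, h a₀, …, h ^ (n - 1) a₀` is a `ℤ`-basis of `H`. -/
def IsCompanionBlock {H : Type*} [AddCommGroup H] [Module.Free ℤ H] [Module.Finite ℤ H]
    (h : Module.End ℤ H) : Prop :=
  1 ≤ Module.finrank ℤ H ∧
  ∃ a₀ : H,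
    LinearIndependent ℤ (fun j : Fin (Module.finrank ℤ H) => (h ^ (j : ℕ)) a₀) ∧
    Submodule.span ℤ (Set.range fun j : Fin (Module.finrank ℤ H) => (h ^ (j : ℕ)) a₀) = ⊤

/-- `(H, h)` is an Orlik block: a companion block such that `h` is an automorphism of finite
order. (`IsOfFinOrder h` says that `h ^ n = 1` for some `n ≥ 1`; such an `h` is invertible.) -/
def IsOrlikBlock {H : Type*} [AddCommGroup H] [Module.Free ℤ H] [Module.Finite ℤ H]
    (h : Module.End ℤ H) : Prop :=
  IsCompanionBlock h ∧ IsOfFinOrder h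

/-- `(H, h)` admits a standard decomposition into Orlik blocks: `H` is the (internal) direct sum
of `h`-invariant sublattices `B 0, …, B (k - 1)`, each of which is an Orlik block with respect to
the restriction of `h`, and the characteristic polynomials of the restrictions divide each other:
that of a later block divides that of every earlier block. -/
def HasStandardOrlikDecomposition {H : Type*} [AddCommGroup H] [Module.Free ℤ H]
    [Module.Finite ℤ H] (h : Module.End ℤ H) : Prop :=
  ∃ (k : ℕ) (B : Fin k → Submodule ℤ H) (hB : ∀ i, ∀ x ∈ B i, h x ∈ B i),
    DirectSum.IsInternal B ∧
    (∀ i, IsOrlikBlock (h.restrict (hB i))) ∧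
    ∀ i j, i ≤ j → (h.restrict (hB j)).charpoly ∣ (h.restrict (hB i)).charpoly

/-! ### The Orlik block of a finite set of orders of eigenvalues -/

/-- `p_M = ∏_{m ∈ M} Φ_m`. -/
def cyclotomicProd (M : Finset ℕ) : ℤ[X] := ∏ m ∈ M, cyclotomic m ℤ

theorem cyclotomicProd_monic (M : Finset ℕ) : (cyclotomicProd M).Monic :=
  monic_prod_of_monic _ _ fun m _ => cyclotomic.monic m ℤ

/-- The lattice `Or(M) = ℤ[t] / (p_M)`. -/
abbrev Or (M : Finset ℕ) : Type := AdjoinRoot (cyclotomicProd M)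

instance (M : Finset ℕ) : Module.Free ℤ (Or M) := (cyclotomicProd_monic M).free_adjoinRoot

instance (M : Finset ℕ) : Module.Finite ℤ (Or M) := (cyclotomicProd_monic M).finite_adjoinRoot

/-- The monodromy of `Or(M)`: multiplication by the class of `t`. -/
def monodromy (M : Finset ℕ) : Module.End ℤ (Or M) :=
  LinearMap.mulLeft ℤ (AdjoinRoot.root (cyclotomicProd M))

/-! ### The graph of `p`-edges

The vertices are the positive integers. -/

/-- The set `E_p` of `p`-edges: pairs `(m, n)` of positive integers such that `m / n = p ^ k`
for some `k ≥ 1`. -/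
def pEdges (p : ℕ) : Set (ℕ × ℕ) :=
  {e | 0 < e.1 ∧ 0 < e.2 ∧ ∃ k : ℕ, 1 ≤ k ∧ e.1 = p ^ k * e.2}

/-- The set `E_p(S) = E_p ∩ S²` of `p`-edges of the restriction of the graph to `S`. -/
def pEdgesOn (p : ℕ) (S : Set ℕ) : Set (ℕ × ℕ) := pEdges p ∩ S ×ˢ S

/-- The map `γ_μ`, `m ↦ m / gcd(m, μ)` (the division is exact). -/
def gammaMap (μ m : ℕ) : ℕ := m / Nat.gcd m μ

/-- The fiber of `γ_μ` over `n` in the positive integers. -/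
def gammaFiber (μ n : ℕ) : Set ℕ := {m | 0 < m ∧ gammaMap μ m = n}

/-- The pair `(M, μ)` is sdiOb-sufficient: for every prime `p` and every `p`-edge `(a, b)` of
`γ_μ(M)`, all `p`-edges from `γ_μ⁻¹(a) ∩ M` to `γ_μ⁻¹(b)` are in `M`, or all `p`-edges from
`γ_μ⁻¹(a)` to `γ_μ⁻¹(b) ∩ M` are in `M`. -/
def IsSdiObSufficient (M : Finset ℕ) (μ : ℕ) : Prop :=
  ∀ p : ℕ, p.Prime → ∀ a b : ℕ, (a, b) ∈ pEdgesOn p (gammaMap μ '' (M : Set ℕ)) →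
    pEdges p ∩ ((gammaFiber μ a ∩ (M : Set ℕ)) ×ˢ gammaFiber μ b) ⊆ pEdgesOn p (M : Set ℕ) ∨
    pEdges p ∩ (gammaFiber μ a ×ˢ (gammaFiber μ b ∩ (M : Set ℕ))) ⊆ pEdgesOn p (M : Set ℕ)

end

end OrlikBlocks

/-!
Write `t` for the class of the variable in `Or(M) = ℤ[t] / (p_M)`, and let polynomials `q ∈ ℤ[X]`
act on `Or(M)` through `q(t ^ μ)`. For `n` in `γ_μ(M)` the primitive `n`-th roots of unity are
eigenvalues of `t ^ μ` of multiplicity `r_n = ∑ φ(m) / φ(n)`, the sum over the `m ∈ M` with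
`γ_μ m = n` (`fiberRank`). The block with index `j` (counted from `0`) has to have the
characteristic polynomial `∏_{r_n > j} Φ_n`.

The decisive fact is `span_root_pow_eq_top`: if `(M, μ)` is sufficient and all `r_n` are at most
`j`, then `1, t, …, t ^ (j - 1)` generate `Or(M)` over `ℤ[t ^ μ]`. By Nakayama's lemma this can be
checked modulo the maximal ideals of `ℤ[t ^ μ]`. Their residue fields `k` have positive
characteristic `p`, and there the claim is that the greatest common divisor of `p_M` and
`X ^ μ - x` in `k[X]`, where `x` is the class of `t ^ μ`, has degree at most `j`
(`natDegree_le_of_dvd_of_dvd`). A root of this divisor has an order `m` prime to `p`. Its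
multiplicity is bounded by the `p`-part `p ^ s` of `μ`, and by the sum of `φ(p ^ k)` over all
`p ^ k * m ∈ M`. The numbers `p ^ k * m` are mapped by `γ_μ` to `p ^ e * n`, where `n` is the order
of `x` and `e = max (k - s) 0`. For every level `e`, the part of that sum belonging to `e`, divided
by `φ(p ^ e)`, is a weight which is at most `p ^ s`, and the sum of the weights over all `μ`-th
roots of `x` is at most `r_{p ^ e n}`. Sufficiency says that of two levels, one has the full
weight `p ^ s` wherever the other one has nonzero weight. So the weights are totally ordered as
functions of the root, and the largest of them bounds the multiplicities at all roots at once.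

Applied to the part of `M` where `r_{γ_μ m} ≤ j`, the decisive fact gives an element
`g_j = t ^ j - ∑_{i < j} a_i(t ^ μ) t ^ i` which is killed by `∏_{r_n > j} Φ_n(t ^ μ)`. For
`j < r = max r_n` these elements generate `Or(M)` over `ℤ[t ^ μ]`, because they arise from
`1, t, …, t ^ (r - 1)` by a unitriangular substitution. As the degrees of the annihilating
polynomials add up to the rank of `Or(M)`, the sum of the cyclic submodules is direct and these
polynomials are the characteristic polynomials of the blocks.
-/

namespace OrlikBlocks

noncomputable section

/-! ### Arithmetic of the map `γ_μ` -/

theorem gammaMap_dvd (μ m : ℕ) : gammaMap μ m ∣ m :=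
  Nat.div_dvd_of_dvd (Nat.gcd_dvd_left m μ)

theorem gammaMap_pos {μ m : ℕ} (hm : 0 < m) : 0 < gammaMap μ m :=
  Nat.pos_of_dvd_of_pos (gammaMap_dvd μ m) hm

/-- `γ_μ` acts separately on the `p`-part and on the prime-to-`p` part of its argument. -/
theorem gammaMap_prime_pow_mul {p μ m k : ℕ} (hp : p.Prime) (hμ : 0 < μ) (hm : p.Coprime m) :
    gammaMap μ (p ^ k * m) = p ^ (k - μ.factorization p) * gammaMap μ m := by
  set s := μ.factorization p
  have hμs : p ^ s * (μ / p ^ s) = μ := Nat.ordProj_mul_ordCompl_eq_self μ p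
  have hc : p.Coprime (μ / p ^ s) := Nat.coprime_ordCompl hp hμ.ne'
  have h1 : Nat.gcd (p ^ k * m) μ = p ^ min k s * Nat.gcd m μ := by
    rw [Nat.gcd_comm, (hm.pow_left k).gcd_mul, Nat.gcd_comm μ m]
    congr 1
    conv_lhs => rw [← hμs]
    rw [Nat.gcd_comm, Nat.Coprime.gcd_mul_right_cancel_right _ (hc.pow_left k).symm]
    rcases le_total k s with h | h
    · rw [min_eq_left h, Nat.gcd_eq_left (pow_dvd_pow p h)]
    · rw [min_eq_right h, Nat.gcd_eq_right (pow_dvd_pow p h)]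
  rw [gammaMap, h1, Nat.mul_div_mul_comm (pow_dvd_pow p (min_le_left k s))
    (Nat.gcd_dvd_left m μ), Nat.pow_div (min_le_left k s) hp.pos, gammaMap]
  congr 2
  omega

/-- The multiplicity with which the primitive `n`-th roots of unity are eigenvalues of the `μ`-th
power of the monodromy of `Or(M)`. -/
def fiberRank (M : Finset ℕ) (μ n : ℕ) : ℕ :=
  ∑ m ∈ M with gammaMap μ m = n, m.totient / n.totient

theorem fiberRank_mul_totient (M : Finset ℕ) (μ n : ℕ) :
    fiberRank M μ n * n.totient = ∑ m ∈ M with gammaMap μ m = n, m.totient := by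
  rw [fiberRank, Finset.sum_mul]
  refine Finset.sum_congr rfl fun m hm => ?_
  rw [Finset.mem_filter] at hm
  exact Nat.div_mul_cancel (Nat.totient_dvd_of_dvd (hm.2 ▸ gammaMap_dvd μ m))

theorem sum_fiberRank_mul_totient (M : Finset ℕ) (μ : ℕ) :
    ∑ n ∈ M.image (gammaMap μ), fiberRank M μ n * n.totient = ∑ m ∈ M, m.totient := by
  simp_rw [fiberRank_mul_totient]
  exact Finset.sum_fiberwise_of_maps_to (fun m hm => Finset.mem_image_of_mem _ hm) _

/-! ### The contribution of one prime-to-`p` order -/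

/-- For `m` prime to `p`, the contribution of the numbers `p ^ k * m ∈ M` to the multiplicity
`fiberRank M μ (p ^ e * γ_μ m)`, divided by the number `φ m / φ (γ_μ m)` of elements of order `m`
with a given `μ`-th power. -/
def levelWeight (p μ : ℕ) (M : Finset ℕ) (e m : ℕ) : ℕ :=
  ∑ k ∈ Finset.range (μ.factorization p + e + 1) with
    k - μ.factorization p = e ∧ p ^ k * m ∈ M, (p ^ k).totient / (p ^ e).totient

theorem sum_level_totient {p : ℕ} (hp : p.Prime) (s e : ℕ) :
    ∑ k ∈ Finset.range (s + e + 1) with k - s = e, (p ^ k).totient / (p ^ e).totient = p ^ s := by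
  rcases Nat.eq_zero_or_pos e with rfl | he
  · rw [Finset.filter_true_of_mem fun k hk => by rw [Finset.mem_range] at hk; omega]
    conv_rhs => rw [← Nat.sum_totient (p ^ s), Nat.divisors_prime_pow hp, Finset.sum_map]
    simp
  · have : Finset.filter (fun k => k - s = e) (Finset.range (s + e + 1)) = {s + e} := by
      ext k
      simp only [Finset.mem_filter, Finset.mem_range, Finset.mem_singleton]
      omega
    rw [this, Finset.sum_singleton, Nat.totient_prime_pow hp (by omega),
      Nat.totient_prime_pow hp he, Nat.add_sub_assoc he, pow_add, mul_assoc]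
    refine Nat.mul_div_cancel _ (Nat.mul_pos (pow_pos hp.pos _) ?_)
    have := hp.two_le
    omega

theorem levelWeight_le {p : ℕ} (hp : p.Prime) (μ : ℕ) (M : Finset ℕ) (e m : ℕ) :
    levelWeight p μ M e m ≤ p ^ μ.factorization p := by
  rw [← sum_level_totient hp _ e, levelWeight]
  refine Finset.sum_le_sum_of_subset fun k hk => ?_
  simp only [Finset.mem_filter] at hk ⊢
  exact ⟨hk.1, hk.2.1⟩

theorem levelWeight_eq {p : ℕ} (hp : p.Prime) {μ : ℕ} {M : Finset ℕ} {e m : ℕ}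
    (h : ∀ k, k - μ.factorization p = e → p ^ k * m ∈ M) :
    levelWeight p μ M e m = p ^ μ.factorization p := by
  rw [← sum_level_totient hp _ e, levelWeight]
  congr 1
  exact Finset.filter_congr fun k _ => ⟨fun hk => hk.1, fun hk => ⟨hk, h k hk⟩⟩

theorem levelWeight_eq_zero {p μ : ℕ} {M : Finset ℕ} {e m : ℕ}
    (h : ∀ k, k - μ.factorization p = e → p ^ k * m ∉ M) : levelWeight p μ M e m = 0 := by
  rw [levelWeight, Finset.filter_false_of_mem fun k _ hk => h k hk.1 hk.2, Finset.sum_empty]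

/-- For `m` prime to `p`, the weight as a sum over the elements of `M` themselves. -/
theorem levelWeight_eq_sum {p : ℕ} (hp : p.Prime) {μ : ℕ} (hμ : 0 < μ) {M : Finset ℕ}
    (hM : ∀ m ∈ M, 0 < m) {m₀ : ℕ} (hm₀ : p.Coprime m₀) (e : ℕ) :
    levelWeight p μ M e m₀ = ∑ m ∈ M with gammaMap μ m = p ^ e * gammaMap μ m₀ ∧
      m / p ^ m.factorization p = m₀, (p ^ m.factorization p).totient / (p ^ e).totient := by
  have hfac : ∀ m ∈ M, m / p ^ m.factorization p = m₀ → m = p ^ m.factorization p * m₀ := by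
    intro m _ h
    rw [← h, Nat.ordProj_mul_ordCompl_eq_self]
  have hcard : ∀ k, p ^ k * m₀ ∈ M → (p ^ k * m₀).factorization p = k := by
    intro k hk
    have h0 : m₀ ≠ 0 := by
      rintro rfl
      exact absurd (hM _ hk) (by simp)
    rw [Nat.factorization_mul (pow_pos hp.pos k).ne' h0, Finsupp.add_apply,
      hp.factorization_pow, Finsupp.single_eq_same,
      Nat.factorization_eq_zero_of_not_dvd (hp.coprime_iff_not_dvd.1 hm₀), add_zero]
  have hg : ∀ m ∈ M, m / p ^ m.factorization p = m₀ →
      (gammaMap μ m = p ^ e * gammaMap μ m₀ ↔ m.factorization p - μ.factorization p = e) := by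
    intro m hm h
    have h0 : 0 < gammaMap μ m₀ := by
      refine gammaMap_pos (Nat.pos_of_ne_zero ?_)
      rintro rfl
      exact absurd (hfac m hm h) (hM m hm).ne'
    have h' : gammaMap μ m = p ^ (m.factorization p - μ.factorization p) * gammaMap μ m₀ := by
      conv_lhs => rw [hfac m hm h]
      exact gammaMap_prime_pow_mul hp hμ hm₀
    rw [h', Nat.mul_left_inj h0.ne', Nat.pow_right_inj hp.two_le]
  rw [levelWeight]
  refine Finset.sum_nbij' (fun k => p ^ k * m₀) (fun m => m.factorization p) ?_ ?_ ?_ ?_ ?_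
  · intro k hk
    simp only [Finset.mem_filter] at hk ⊢
    have h1 := hcard k hk.2.2
    have h2 : p ^ k * m₀ / p ^ (p ^ k * m₀).factorization p = m₀ := by
      rw [h1]
      exact Nat.mul_div_cancel_left _ (pow_pos hp.pos k)
    exact ⟨hk.2.2, (hg _ hk.2.2 h2).2 (by rw [h1]; exact hk.2.1), h2⟩
  · intro m hm
    simp only [Finset.mem_filter, Finset.mem_range] at hm ⊢
    have h1 := (hg m hm.1 hm.2.2).1 hm.2.1
    refine ⟨by omega, h1, ?_⟩
    rw [← hfac m hm.1 hm.2.2]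
    exact hm.1
  · intro k hk
    simp only [Finset.mem_filter] at hk
    exact hcard k hk.2.2
  · intro m hm
    simp only [Finset.mem_filter] at hm
    exact (hfac m hm.1 hm.2.2).symm
  · intro k hk
    simp only [Finset.mem_filter] at hk
    rw [hcard k hk.2.2]

/-- The two inclusions in the definition of sufficiency make the weights of two levels, as
functions of the prime-to-`p` order `m` in a fixed fiber of `γ_μ`, comparable. -/
theorem levelWeight_le_or_le_of_lt {p : ℕ} (hp : p.Prime) {μ : ℕ} (hμ : 0 < μ) {M : Finset ℕ}
    (hsuff : IsSdiObSufficient M μ) {n e e' : ℕ} (hn : 0 < n) (hlt : e' < e)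
    (he : p ^ e * n ∈ M.image (gammaMap μ)) (he' : p ^ e' * n ∈ M.image (gammaMap μ)) :
    (∀ m, p.Coprime m → gammaMap μ m = n →
      levelWeight p μ M e m ≤ levelWeight p μ M e' m) ∨
    (∀ m, p.Coprime m → gammaMap μ m = n →
      levelWeight p μ M e' m ≤ levelWeight p μ M e m) := by
  have hpos : ∀ m, gammaMap μ m = n → 0 < m := by
    intro m h
    rcases Nat.eq_zero_or_pos m with rfl | h0
    · simp [gammaMap] at h
      omega
    · exact h0
  have hfib : ∀ m k i, p.Coprime m → gammaMap μ m = n → k - μ.factorization p = i →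
      p ^ k * m ∈ gammaFiber μ (p ^ i * n) := by
    intro m k i hm h hk
    exact ⟨Nat.mul_pos (pow_pos hp.pos k) (hpos m h), by
      rw [gammaMap_prime_pow_mul hp hμ hm, h, hk]⟩
  have hedge : ∀ m k k', gammaMap μ m = n → k - μ.factorization p = e →
      k' - μ.factorization p = e' → (p ^ k * m, p ^ k' * m) ∈ pEdges p := by
    intro m k k' h hk hk'
    refine ⟨Nat.mul_pos (pow_pos hp.pos k) (hpos m h), Nat.mul_pos (pow_pos hp.pos k') (hpos m h),
      k - k', by omega, ?_⟩
    change p ^ k * m = p ^ (k - k') * (p ^ k' * m)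
    rw [← mul_assoc, ← pow_add]
    congr 2
    omega
  have hE : (p ^ e * n, p ^ e' * n) ∈ pEdgesOn p (gammaMap μ '' (M : Set ℕ)) := by
    refine ⟨⟨Nat.mul_pos (pow_pos hp.pos _) hn, Nat.mul_pos (pow_pos hp.pos _) hn, e - e',
      by omega, ?_⟩, ?_, ?_⟩
    · change p ^ e * n = p ^ (e - e') * (p ^ e' * n)
      rw [← mul_assoc, ← pow_add]
      congr 2
      omega
    · simpa using he
    · simpa using he'
  rcases hsuff p hp _ _ hE with h | h
  · left
    intro m hm hmn
    by_cases hex : ∃ k, k - μ.factorization p = e ∧ p ^ k * m ∈ M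
    · obtain ⟨k, hk, hkM⟩ := hex
      rw [levelWeight_eq (e := e') hp fun k' hk' => ?_]
      · exact levelWeight_le hp μ M e m
      · exact (h ⟨hedge m k k' hmn hk hk', ⟨hfib m k e hm hmn hk, hkM⟩,
          hfib m k' e' hm hmn hk'⟩).2.2
    · push Not at hex
      rw [levelWeight_eq_zero hex]
      exact Nat.zero_le _
  · right
    intro m hm hmn
    by_cases hex : ∃ k, k - μ.factorization p = e' ∧ p ^ k * m ∈ M
    · obtain ⟨k', hk', hkM⟩ := hex
      rw [levelWeight_eq (e := e) hp fun k hk => ?_]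
      · exact levelWeight_le hp μ M e' m
      · exact (h ⟨hedge m k k' hmn hk hk', hfib m k e hm hmn hk,
          hfib m k' e' hm hmn hk', hkM⟩).2.1
    · push Not at hex
      rw [levelWeight_eq_zero hex]
      exact Nat.zero_le _

theorem levelWeight_le_or_le {p : ℕ} (hp : p.Prime) {μ : ℕ} (hμ : 0 < μ) {M : Finset ℕ}
    (hsuff : IsSdiObSufficient M μ) {n e e' : ℕ} (hn : 0 < n)
    (he : p ^ e * n ∈ M.image (gammaMap μ)) (he' : p ^ e' * n ∈ M.image (gammaMap μ)) :
    (∀ m, p.Coprime m → gammaMap μ m = n →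
      levelWeight p μ M e m ≤ levelWeight p μ M e' m) ∨
    (∀ m, p.Coprime m → gammaMap μ m = n →
      levelWeight p μ M e' m ≤ levelWeight p μ M e m) := by
  rcases lt_trichotomy e' e with h | rfl | h
  · exact levelWeight_le_or_le_of_lt hp hμ hsuff hn h he he'
  · exact Or.inl fun m _ _ => le_rfl
  · exact (levelWeight_le_or_le_of_lt hp hμ hsuff hn h he' he).symm

/-! ### Roots of unity with a given power -/

/-- An exponent prime to a divisor `n` of `m` is congruent modulo `n` to one prime to `m`. -/
theorem exists_coprime_modEq {m n i : ℕ} (hm : 0 < m) (hnm : n ∣ m) (hi : i.Coprime n) :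
    ∃ u : ℕ, u.Coprime m ∧ u ≡ i [MOD n] := by
  have : NeZero m := ⟨hm.ne'⟩
  obtain ⟨v, hv⟩ := ZMod.unitsMap_surjective hnm (ZMod.unitOfCoprime i hi)
  refine ⟨(v : ZMod m).val, ZMod.val_coe_unit_coprime v, ?_⟩
  have h := congrArg Units.val hv
  rw [ZMod.unitsMap_val, ZMod.coe_unitOfCoprime, ZMod.cast_eq_val] at h
  exact (ZMod.natCast_eq_natCast_iff _ _ _).1 h

/-- At most `φ m / φ (γ_μ m)` elements of order `m` share their `μ`-th power: for every other
element of order `γ_μ m`, a power map injects the fiber over the given one into the fiber over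
the other one. -/
theorem card_filter_orderOf_mul_totient_le {K : Type*} [Field K] [DecidableEq K] {μ m : ℕ}
    (hμ : 0 < μ) (hm : 0 < m) {x : K} {T : Finset K} (hT : ∀ ξ ∈ T, ξ ^ μ = x) :
    (T.filter fun ξ => orderOf ξ = m).card * (gammaMap μ m).totient ≤ m.totient := by
  rcases (T.filter fun ξ => orderOf ξ = m).eq_empty_or_nonempty with h | ⟨ξ₀, hξ₀⟩
  · rw [h]
    simp
  obtain ⟨hξT, hξ₀⟩ := Finset.mem_filter.1 hξ₀
  have hord : ∀ ξ : K, orderOf ξ = m → orderOf (ξ ^ μ) = gammaMap μ m := by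
    intro ξ h
    rw [orderOf_pow' ξ hμ.ne', h, gammaMap]
  have hξp : IsPrimitiveRoot ξ₀ m := hξ₀ ▸ IsPrimitiveRoot.orderOf ξ₀
  have hn : 0 < gammaMap μ m := gammaMap_pos hm
  have hx : IsPrimitiveRoot x (gammaMap μ m) := by
    rw [← hT ξ₀ hξT, ← hord ξ₀ hξ₀]
    exact IsPrimitiveRoot.orderOf _
  have hmaps : ∀ ξ ∈ primitiveRoots m K, ξ ^ μ ∈ primitiveRoots (gammaMap μ m) K := by
    intro ξ hξ
    rw [mem_primitiveRoots hm] at hξ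
    rw [mem_primitiveRoots hn, ← hord ξ hξ.eq_orderOf.symm]
    exact IsPrimitiveRoot.orderOf _
  rw [← hξp.card_primitiveRoots, ← hx.card_primitiveRoots, mul_comm,
    Finset.card_eq_sum_card_fiberwise hmaps, ← smul_eq_mul]
  refine Finset.card_nsmul_le_sum _ _ _ fun y hy => ?_
  rw [mem_primitiveRoots hn] at hy
  have : NeZero (gammaMap μ m) := ⟨hn.ne'⟩
  obtain ⟨i, -, hic, rfl⟩ := hx.isPrimitiveRoot_iff.1 hy
  obtain ⟨u, hum, hui⟩ := exists_coprime_modEq hm (gammaMap_dvd μ m) hic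
  refine Finset.card_le_card_of_injOn (fun ξ => ξ ^ u) ?_ ?_
  · intro ξ hξ
    obtain ⟨hξT', hξm⟩ := Finset.mem_filter.1 (Finset.mem_coe.1 hξ)
    refine Finset.mem_coe.2 (Finset.mem_filter.2 ⟨?_, ?_⟩)
    · rw [mem_primitiveRoots hm]
      exact (hξm ▸ IsPrimitiveRoot.orderOf ξ).pow_of_coprime u hum
    · change (ξ ^ u) ^ μ = x ^ i
      rw [← pow_mul, mul_comm, pow_mul, hT ξ hξT']
      exact pow_eq_pow_of_modEq hui hx.pow_eq_one
  · intro ξ hξ ζ hζ h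
    obtain ⟨-, hξm⟩ := Finset.mem_filter.1 (Finset.mem_coe.1 hξ)
    obtain ⟨-, hζm⟩ := Finset.mem_filter.1 (Finset.mem_coe.1 hζ)
    obtain ⟨v, -, hv⟩ := Nat.exists_mul_mod_eq_of_coprime 1 hum hm.ne'
    have key : ∀ η : K, orderOf η = m → (η ^ u) ^ v = η := by
      intro η hη
      rw [← pow_mul]
      conv_rhs => rw [← pow_one η]
      exact pow_eq_pow_of_modEq hv (hη ▸ pow_orderOf_eq_one η)
    rw [← key ξ hξm, ← key ζ hζm]
    exact congrArg (· ^ v) h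

/-! ### Multiplicities of roots in characteristic `p` -/

theorem count_roots_X_pow_sub_C_le {K : Type*} [Field K] [IsAlgClosed K] [DecidableEq K] (p : ℕ)
    [Fact p.Prime] [CharP K p] {μ : ℕ} (hμ : 0 < μ) {x : K} (hx : x ≠ 0) (ξ : K) :
    (X ^ μ - C x : K[X]).roots.count ξ ≤ p ^ μ.factorization p := by
  have hp : p.Prime := Fact.out
  set s := μ.factorization p
  have hμs : p ^ s * (μ / p ^ s) = μ := Nat.ordProj_mul_ordCompl_eq_self μ p
  have hc : p.Coprime (μ / p ^ s) := Nat.coprime_ordCompl hp hμ.ne'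
  obtain ⟨y, hy⟩ := IsAlgClosed.exists_pow_nat_eq x (pow_pos hp.pos s)
  have hy0 : y ≠ 0 := by
    rintro rfl
    rw [zero_pow (pow_pos hp.pos s).ne'] at hy
    exact hx hy.symm
  have hfac : (X ^ μ - C x : K[X]) = (X ^ (μ / p ^ s) - C y) ^ p ^ s := by
    rw [sub_pow_char_pow, ← pow_mul, mul_comm (μ / p ^ s), hμs, ← C_pow, hy]
  have hsep : (X ^ (μ / p ^ s) - C y : K[X]).Separable := by
    refine separable_X_pow_sub_C y ?_ hy0
    rw [Ne, CharP.cast_eq_zero_iff K p]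
    exact hp.coprime_iff_not_dvd.1 hc
  rw [hfac, roots_pow, Multiset.count_nsmul, count_roots]
  exact (Nat.mul_le_mul_left _ (rootMultiplicity_le_one_of_separable hsep ξ)).trans (mul_one _).le

theorem count_roots_cyclotomic_le {K : Type*} [Field K] [DecidableEq K] (p : ℕ)
    [Fact p.Prime] [CharP K p] {m : ℕ} (hm : 0 < m) (ξ : K) :
    (cyclotomic m K).roots.count ξ ≤
      if m / p ^ m.factorization p = orderOf ξ then (p ^ m.factorization p).totient else 0 := by
  have hp : p.Prime := Fact.out
  set k := m.factorization p
  have hmk : p ^ k * (m / p ^ k) = m := Nat.ordProj_mul_ordCompl_eq_self m p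
  have hc : p.Coprime (m / p ^ k) := Nat.coprime_ordCompl hp hm.ne'
  have hnd : ¬ p ∣ m / p ^ k := hp.coprime_iff_not_dvd.1 hc
  have : NeZero ((m / p ^ k : ℕ) : K) := ⟨by rwa [Ne, CharP.cast_eq_zero_iff K p]⟩
  split_ifs with h
  · have hsep := rootMultiplicity_le_one_of_separable (separable_cyclotomic (m / p ^ k) K) ξ
    rcases Nat.eq_zero_or_pos k with hk | hk
    · rw [hk, pow_zero, one_mul] at hmk
      rw [count_roots, ← hmk, hk, pow_zero, Nat.totient_one, Nat.div_one]
      simpa [hk] using hsep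
    · conv_lhs => rw [← hmk, cyclotomic_mul_prime_pow_eq K hnd hk]
      rw [roots_pow, Multiset.count_nsmul, count_roots, Nat.totient_prime_pow hp hk]
      refine (Nat.mul_le_mul_left _ hsep).trans ?_
      rw [mul_one, Nat.mul_sub, mul_one, ← pow_succ, Nat.sub_add_cancel hk]
  · refine (Multiset.count_eq_zero.2 fun hmem => h ?_).le
    have hr := isRoot_of_mem_roots hmem
    rw [← hmk, isRoot_cyclotomic_prime_pow_mul_iff_of_charP (p := p)] at hr
    exact hr.eq_orderOf

theorem count_roots_cyclotomicProd_le {K : Type*} [Field K] [DecidableEq K] (p : ℕ)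
    [Fact p.Prime] [CharP K p] {M : Finset ℕ} (hM : ∀ m ∈ M, 0 < m) (ξ : K) :
    ((cyclotomicProd M).map (Int.castRingHom K)).roots.count ξ ≤
      ∑ m ∈ M with m / p ^ m.factorization p = orderOf ξ, (p ^ m.factorization p).totient := by
  have h0 : (∏ m ∈ M, cyclotomic m K) ≠ 0 := Finset.prod_ne_zero_iff.2 fun m _ =>
    cyclotomic_ne_zero m K
  have hmap : (cyclotomicProd M).map (Int.castRingHom K) = ∏ m ∈ M, cyclotomic m K := by
    rw [cyclotomicProd, Polynomial.map_prod]
    exact Finset.prod_congr rfl fun m _ => map_cyclotomic_int m K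
  rw [hmap, roots_prod _ _ h0, Multiset.count_bind, Finset.sum_filter]
  exact Finset.sum_le_sum fun m hm => count_roots_cyclotomic_le p (hM m hm) ξ

/-! ### The degree bound over a residue field -/

/-- The weights of the `μ`-th roots of `x` add up to at most the multiplicity of the level. -/
theorem sum_levelWeight_orderOf_le {K : Type*} [Field K] [DecidableEq K] {p : ℕ}
    (hp : p.Prime) {μ : ℕ} (hμ : 0 < μ) {M : Finset ℕ} (hM : ∀ m ∈ M, 0 < m) {n : ℕ} {x : K}
    {T : Finset K} (hT : ∀ ξ ∈ T, ξ ^ μ = x) (hc : ∀ ξ ∈ T, p.Coprime (orderOf ξ))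
    (hn : ∀ ξ ∈ T, gammaMap μ (orderOf ξ) = n) (e : ℕ) :
    ∑ ξ ∈ T, levelWeight p μ M e (orderOf ξ) ≤ fiberRank M μ (p ^ e * n) := by
  have h1 : ∀ ξ ∈ T, levelWeight p μ M e (orderOf ξ) =
      ∑ m ∈ M with gammaMap μ m = p ^ e * n, if orderOf ξ = m / p ^ m.factorization p then
        (p ^ m.factorization p).totient / (p ^ e).totient else 0 := by
    intro ξ hξ
    rw [levelWeight_eq_sum hp hμ hM (hc ξ hξ), hn ξ hξ, ← Finset.sum_filter, Finset.filter_filter]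
    refine Finset.sum_congr (Finset.filter_congr fun m _ => ?_) fun _ _ => rfl
    rw [eq_comm (a := orderOf ξ)]
  rw [Finset.sum_congr rfl h1, Finset.sum_comm, fiberRank]
  refine Finset.sum_le_sum fun m hm => ?_
  obtain ⟨hmM, hmn⟩ := Finset.mem_filter.1 hm
  rw [← Finset.sum_filter, Finset.sum_const, smul_eq_mul]
  set k := m.factorization p
  have hmk : p ^ k * (m / p ^ k) = m := Nat.ordProj_mul_ordCompl_eq_self m p
  have hmc : p.Coprime (m / p ^ k) := Nat.coprime_ordCompl hp (hM m hmM).ne'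
  have hm0 : 0 < m / p ^ k := by
    refine Nat.pos_of_ne_zero fun h => (hM m hmM).ne' ?_
    rw [← hmk, h, mul_zero]
  rcases (T.filter fun ξ => orderOf ξ = m / p ^ k).eq_empty_or_nonempty with h | ⟨ξ, hξ⟩
  · rw [h]
    simp
  obtain ⟨hξT, hξm⟩ := Finset.mem_filter.1 hξ
  have hγ : gammaMap μ (m / p ^ k) = n := by rw [← hξm, hn ξ hξT]
  have hcard := card_filter_orderOf_mul_totient_le hμ hm0 hT
  rw [hγ] at hcard
  have hn0 : 0 < n := hγ ▸ gammaMap_pos hm0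
  have hnm : n ∣ m / p ^ k := hγ ▸ gammaMap_dvd μ _
  have hcn : p.Coprime n := hmc.coprime_dvd_right hnm
  have hek : p ^ e ∣ p ^ k := by
    refine (hcn.pow_left e).dvd_of_dvd_mul_right ?_
    have := gammaMap_prime_pow_mul (k := k) hp hμ hmc
    rw [hmk, hmn, hγ, Nat.mul_left_inj hn0.ne', Nat.pow_right_inj hp.two_le] at this
    exact (pow_dvd_pow p (by omega)).trans (dvd_mul_right _ n)
  conv_rhs => rw [← hmk, Nat.totient_mul (hmc.pow_left k), Nat.totient_mul (hcn.pow_left e),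
    Nat.mul_div_mul_comm (Nat.totient_dvd_of_dvd hek) (Nat.totient_dvd_of_dvd hnm)]
  rw [mul_comm]
  exact Nat.mul_le_mul_left _ ((Nat.le_div_iff_mul_le (Nat.totient_pos.2 hn0)).2 hcard)

/-- In characteristic `p`, a common divisor of `p_M` and `X ^ μ - x` has degree at most the
largest multiplicity. A root of order `m` has multiplicity at most `p ^ s` by the second
divisibility, where `p ^ s` is the exact power of `p` dividing `μ`, and at most
`∑ φ (p ^ k)` over all `p ^ k * m ∈ M` by the first one. As the weights of the different levels
are comparable, the largest of them bounds this multiplicity at all roots simultaneously. -/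
theorem natDegree_le_of_dvd_of_dvd {K : Type*} [Field K] [IsAlgClosed K] (p : ℕ)
    [Fact p.Prime] [CharP K p] {μ : ℕ} (hμ : 0 < μ) {M : Finset ℕ} (hM : ∀ m ∈ M, 0 < m)
    (hsuff : IsSdiObSufficient M μ) {j : ℕ} (hj : ∀ m ∈ M, fiberRank M μ (gammaMap μ m) ≤ j)
    {x : K} {d : K[X]} (h1 : d ∣ (cyclotomicProd M).map (Int.castRingHom K))
    (h2 : d ∣ X ^ μ - C x) : d.natDegree ≤ j := by
  classical
  have hp : p.Prime := Fact.out
  set s := μ.factorization p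
  have hP0 : (cyclotomicProd M).map (Int.castRingHom K) ≠ 0 :=
    ((cyclotomicProd_monic M).map _).ne_zero
  have hQ0 : (X ^ μ - C x : K[X]) ≠ 0 := X_pow_sub_C_ne_zero hμ x
  have hle1 : ∀ ξ, d.roots.count ξ ≤ _ := fun ξ =>
    (Multiset.count_le_of_le ξ (roots.le_of_dvd hP0 h1)).trans
      (count_roots_cyclotomicProd_le p hM ξ)
  set T := d.roots.toFinset
  have hdeg : d.natDegree = ∑ ξ ∈ T, d.roots.count ξ := by
    rw [(IsAlgClosed.splits d).natDegree_eq_card_roots, Multiset.toFinset_sum_count_eq]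
  have hT : ∀ ξ ∈ T, ξ ^ μ = x := by
    intro ξ hξ
    have := isRoot_of_mem_roots (Multiset.mem_of_le (roots.le_of_dvd hQ0 h2)
      (Multiset.mem_toFinset.1 hξ))
    simpa [sub_eq_zero] using this
  have hTm : ∀ ξ ∈ T, ∃ m ∈ M, m / p ^ m.factorization p = orderOf ξ := by
    intro ξ hξ
    by_contra! hcon
    have h := hle1 ξ
    rw [Finset.filter_false_of_mem hcon, Finset.sum_empty] at h
    exact (Multiset.count_pos.2 (Multiset.mem_toFinset.1 hξ)).not_ge h
  rcases T.eq_empty_or_nonempty with hTe | ⟨ξ₀, hξ₀⟩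
  · rw [hdeg, hTe, Finset.sum_empty]
    exact Nat.zero_le j
  have hc : ∀ ξ ∈ T, p.Coprime (orderOf ξ) := by
    intro ξ hξ
    obtain ⟨m, hm, h⟩ := hTm ξ hξ
    exact h ▸ Nat.coprime_ordCompl hp (hM m hm).ne'
  set n := orderOf x
  have hn : ∀ ξ ∈ T, gammaMap μ (orderOf ξ) = n := by
    intro ξ hξ
    rw [gammaMap, ← orderOf_pow' ξ hμ.ne', hT ξ hξ]
  -- the elements of `M` which lie over the order of a root
  have hmem : ∀ ξ ∈ T, ∀ m ∈ M, m / p ^ m.factorization p = orderOf ξ →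
      m = p ^ m.factorization p * orderOf ξ ∧
      gammaMap μ m = p ^ (m.factorization p - s) * n := by
    intro ξ hξ m hm h
    have h' : p ^ m.factorization p * orderOf ξ = m := by
      rw [← h, Nat.ordProj_mul_ordCompl_eq_self]
    refine ⟨h'.symm, ?_⟩
    conv_lhs => rw [← h']
    rw [gammaMap_prime_pow_mul hp hμ (hc ξ hξ), hn ξ hξ]
  have hnpos : 0 < n := by
    obtain ⟨m, hm, h⟩ := hTm ξ₀ hξ₀
    have := gammaMap_pos (μ := μ) (hM m hm)
    rw [(hmem ξ₀ hξ₀ m hm h).2] at this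
    exact Nat.pos_of_mul_pos_left this
  have hx0 : x ≠ 0 := by
    rintro rfl
    exact hnpos.ne' (orderOf_zero K)
  have hle2 : ∀ ξ, d.roots.count ξ ≤ p ^ s := fun ξ =>
    (Multiset.count_le_of_le ξ (roots.le_of_dvd hQ0 h2)).trans
      (count_roots_X_pow_sub_C_le p hμ hx0 ξ)
  set E := (M.image fun m => m.factorization p - s).filter
    fun e => p ^ e * n ∈ M.image (gammaMap μ)
  have hmemE : ∀ ξ ∈ T, ∀ m ∈ M, m / p ^ m.factorization p = orderOf ξ →
      m.factorization p - s ∈ E := by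
    intro ξ hξ m hm h
    refine Finset.mem_filter.2 ⟨Finset.mem_image_of_mem _ hm, ?_⟩
    rw [← (hmem ξ hξ m hm h).2]
    exact Finset.mem_image_of_mem _ hm
  have hEne : E.Nonempty := by
    obtain ⟨m, hm, h⟩ := hTm ξ₀ hξ₀
    exact ⟨_, hmemE ξ₀ hξ₀ m hm h⟩
  obtain ⟨e, heE, hmax⟩ := E.exists_max_image
    (fun e => ∑ ξ ∈ T, levelWeight p μ M e (orderOf ξ)) hEne
  -- the level `e` with the largest sum dominates all others pointwise
  have hdom : ∀ e' ∈ E, ∀ ξ ∈ T,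
      levelWeight p μ M e' (orderOf ξ) ≤ levelWeight p μ M e (orderOf ξ) := by
    intro e' he' ξ hξ
    rcases levelWeight_le_or_le hp hμ hsuff hnpos (Finset.mem_filter.1 heE).2
      (Finset.mem_filter.1 he').2 with h | h
    · have hpt : ∀ ζ ∈ T, levelWeight p μ M e (orderOf ζ) ≤ levelWeight p μ M e' (orderOf ζ) :=
        fun ζ hζ => h _ (hc ζ hζ) (hn ζ hζ)
      have := (Finset.sum_eq_sum_iff_of_le hpt).1
        (le_antisymm (Finset.sum_le_sum hpt) (hmax e' he')) ξ hξ
      exact this.ge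
    · exact h _ (hc ξ hξ) (hn ξ hξ)
  have hbound : ∀ ξ ∈ T, d.roots.count ξ ≤ levelWeight p μ M e (orderOf ξ) := by
    intro ξ hξ
    by_cases hhigh : ∃ m ∈ M, m / p ^ m.factorization p = orderOf ξ ∧ s < m.factorization p
    · obtain ⟨m, hm, h, hk⟩ := hhigh
      refine le_trans ?_ (hdom _ (hmemE ξ hξ m hm h) ξ hξ)
      rw [levelWeight_eq hp fun k hk' => ?_]
      · exact hle2 ξ
      · have : k = m.factorization p := by omega
        rw [this, ← (hmem ξ hξ m hm h).1]
        exact hm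
    · push Not at hhigh
      have hzero : ∀ m ∈ M, m / p ^ m.factorization p = orderOf ξ →
          m.factorization p - s = 0 := fun m hm h => by
        have := hhigh m hm h
        omega
      have h0E : 0 ∈ E := by
        obtain ⟨m, hm, h⟩ := hTm ξ hξ
        rw [← hzero m hm h]
        exact hmemE ξ hξ m hm h
      refine le_trans ?_ (hdom 0 h0E ξ hξ)
      rw [levelWeight_eq_sum hp hμ hM (hc ξ hξ), hn ξ hξ]
      refine (hle1 ξ).trans (le_of_eq ?_)
      rw [pow_zero, Nat.totient_one]
      simp_rw [Nat.div_one]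
      refine Finset.sum_congr (Finset.filter_congr fun m hm => ⟨fun h => ⟨?_, h⟩, fun h => h.2⟩)
        fun _ _ => rfl
      rw [(hmem ξ hξ m hm h).2, hzero m hm h, pow_zero]
  obtain ⟨m, hm, hmγ⟩ := Finset.mem_image.1 (Finset.mem_filter.1 heE).2
  calc d.natDegree = ∑ ξ ∈ T, d.roots.count ξ := hdeg
    _ ≤ ∑ ξ ∈ T, levelWeight p μ M e (orderOf ξ) := Finset.sum_le_sum hbound
    _ ≤ fiberRank M μ (p ^ e * n) := sum_levelWeight_orderOf_le hp hμ hM hT hc hn e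
    _ ≤ j := hmγ ▸ hj m hm

/-! ### Divisibility by products of cyclotomic polynomials -/

theorem cyclotomicProd_dvd {M : Finset ℕ} {f : ℤ[X]} (h : ∀ m ∈ M, cyclotomic m ℤ ∣ f) :
    cyclotomicProd M ∣ f := by
  rw [← map_dvd_map (Int.castRingHom ℚ) Int.cast_injective (cyclotomicProd_monic M),
    cyclotomicProd, Polynomial.map_prod]
  refine Finset.prod_dvd_of_coprime (fun m _ n _ hmn => ?_) fun m hm =>
    map_dvd (mapRingHom (Int.castRingHom ℚ)) (h m hm)
  simpa [Function.onFun] using cyclotomic.isCoprime_rat hmn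

theorem cyclotomicProd_dvd_X_pow_sub_one {M : Finset ℕ} :
    cyclotomicProd M ∣ X ^ (∏ m ∈ M, m) - 1 :=
  cyclotomicProd_dvd fun m hm => (cyclotomic.dvd_X_pow_sub_one m ℤ).trans <| by
    obtain ⟨c, hc⟩ := Finset.dvd_prod_of_mem (fun m => m) hm
    rw [hc, pow_mul]
    simpa using sub_dvd_pow_sub_pow (X ^ m : ℤ[X]) 1 c

/-- The `μ`-th powers of primitive `m`-th roots of unity have order `γ_μ m`. -/
theorem cyclotomic_dvd_expand {μ m : ℕ} (hμ : 0 < μ) (hm : 0 < m) :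
    cyclotomic m ℤ ∣ expand ℤ μ (cyclotomic (gammaMap μ m) ℤ) := by
  have hζ := Complex.isPrimitiveRoot_exp m hm.ne'
  set ζ := Complex.exp (2 * Real.pi * Complex.I / m)
  rw [cyclotomic_eq_minpoly hζ hm]
  refine minpoly.isIntegrallyClosed_dvd (hζ.isIntegral hm) ?_
  have h : IsPrimitiveRoot (ζ ^ μ) (gammaMap μ m) := by
    rw [gammaMap, hζ.eq_orderOf, ← orderOf_pow' ζ hμ.ne']
    exact IsPrimitiveRoot.orderOf _
  rw [expand_aeval, ← eval_map_algebraMap, map_cyclotomic]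
  exact h.isRoot_cyclotomic (gammaMap_pos hm)

theorem cyclotomicProd_dvd_expand {μ : ℕ} (hμ : 0 < μ) {M N : Finset ℕ} (hM : ∀ m ∈ M, 0 < m)
    (hN : ∀ m ∈ M, gammaMap μ m ∈ N) : cyclotomicProd M ∣ expand ℤ μ (cyclotomicProd N) := by
  refine cyclotomicProd_dvd fun m hm => (cyclotomic_dvd_expand hμ (hM m hm)).trans ?_
  obtain ⟨c, hc⟩ : cyclotomic (gammaMap μ m) ℤ ∣ cyclotomicProd N :=
    Finset.dvd_prod_of_mem (fun n => cyclotomic n ℤ) (hN m hm)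
  rw [hc, map_mul]
  exact dvd_mul_right _ _

theorem natDegree_cyclotomicProd (M : Finset ℕ) :
    (cyclotomicProd M).natDegree = ∑ m ∈ M, m.totient := by
  rw [cyclotomicProd, natDegree_prod_of_monic _ _ fun m _ => cyclotomic.monic m ℤ]
  exact Finset.sum_congr rfl fun m _ => natDegree_cyclotomic m ℤ

/-! ### Generation by powers, checked at the maximal ideals -/

/-- A submodule of a finite module is everything if it is so modulo each maximal ideal. -/
theorem eq_top_of_forall_isMaximal {A H : Type*} [CommRing A] [AddCommGroup H] [Module A H]
    [Module.Finite A H] (N : Submodule A H)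
    (h : ∀ I : Ideal A, I.IsMaximal → N ⊔ I • (⊤ : Submodule A H) = ⊤) : N = ⊤ := by
  set J : Ideal A := N.colon (⊤ : Submodule A H)
  by_cases hJt : J = ⊤
  · refine top_le_iff.1 fun y _ => ?_
    have h1 : (1 : A) ∈ J := hJt ▸ Submodule.mem_top
    simpa using Submodule.mem_colon.1 h1 y trivial
  · obtain ⟨I, hI, hJI⟩ := Ideal.exists_le_maximal J hJt
    obtain ⟨r, hr, hrN⟩ := Submodule.exists_sub_one_mem_and_smul_le_of_fg_of_le_sup
      (I := I) (N := N) (N' := ⊤) (P := ⊤) Module.Finite.fg_top le_rfl (h I hI).ge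
    refine absurd ((Ideal.eq_top_iff_one I).2 ?_) hI.ne_top
    have hrI : r ∈ I := hJI (Submodule.mem_colon.2 fun y _ =>
      hrN (Submodule.smul_mem_pointwise_smul y r ⊤ trivial))
    simpa using I.sub_mem hrI hr

/-- A field which is finite over `ℤ` has positive characteristic. -/
theorem exists_charP_of_finite_int (k : Type*) [Field k] [Module.Finite ℤ k] :
    ∃ p : ℕ, p.Prime ∧ CharP k p := by
  obtain ⟨p, hp⟩ := CharP.exists k
  rcases CharP.char_is_prime_or_zero k p with h | rfl
  · exact ⟨p, h, hp⟩
  · have : CharZero k := CharP.charP_to_charZero k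
    exact absurd (isField_of_isIntegral_of_isField (R := ℤ) (S := k)
      (by simpa using Int.cast_injective) (Field.toIsField k)) Int.not_isField

/-- The subring `ℤ[t ^ μ]` of `Or(M)`. -/
abbrev powerSubring (M : Finset ℕ) (μ : ℕ) : Subalgebra ℤ (Or M) :=
  Algebra.adjoin ℤ {AdjoinRoot.root (cyclotomicProd M) ^ μ}

/-- If no multiplicity exceeds `j`, the powers `1, t, …, t ^ (j - 1)` generate `Or(M)` over
`ℤ[t ^ μ]`. Modulo a maximal ideal with residue field `k`, the module `Or(M)` becomes
`k[X] / (p_M, X ^ μ - x)`, whose dimension is the degree of the greatest common divisor. -/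
theorem span_root_pow_eq_top {μ : ℕ} (hμ : 0 < μ) {M : Finset ℕ} (hM : ∀ m ∈ M, 0 < m)
    (hsuff : IsSdiObSufficient M μ) {j : ℕ} (hj : ∀ m ∈ M, fiberRank M μ (gammaMap μ m) ≤ j) :
    Submodule.span (powerSubring M μ)
      (Set.range fun i : Fin j => AdjoinRoot.root (cyclotomicProd M) ^ (i : ℕ)) = ⊤ := by
  classical
  set t := AdjoinRoot.root (cyclotomicProd M)
  have hfinH : Module.Finite (powerSubring M μ) (Or M) :=
    Module.Finite.of_restrictScalars_finite ℤ _ _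
  have hfinA : Module.Finite ℤ (powerSubring M μ) :=
    Module.Finite.of_injective (powerSubring M μ).val.toLinearMap Subtype.val_injective
  refine eq_top_of_forall_isMaximal _ fun I hI => top_le_iff.1 fun y _ => ?_
  let k := (powerSubring M μ) ⧸ I
  let _ : Field k := Ideal.Quotient.field I
  have hfink : Module.Finite ℤ k :=
    Module.Finite.of_surjective (Ideal.Quotient.mkₐ ℤ I).toLinearMap
      (Ideal.Quotient.mkₐ_surjective ℤ I)
  obtain ⟨p, hp, hchar⟩ := exists_charP_of_finite_int k
  have : Fact p.Prime := ⟨hp⟩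
  let A := powerSubring M μ
  let π : A →+* k := Ideal.Quotient.mk I
  have hπ : Function.Surjective π := Ideal.Quotient.mk_surjective
  let x : A := ⟨t ^ μ, Algebra.subset_adjoin rfl⟩
  -- polynomials which vanish over the residue field take values in `I • ⊤`
  have hI0 : ∀ f : A[X], f.map π = 0 → aeval t f ∈ I • (⊤ : Submodule A (Or M)) := by
    intro f hf
    rw [aeval_eq_sum_range]
    refine Submodule.sum_mem _ fun i _ => Submodule.smul_mem_smul ?_ trivial
    have := congrArg (fun g => g.coeff i) hf
    rw [coeff_map, coeff_zero] at this
    exact Ideal.Quotient.eq_zero_iff_mem.1 this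
  let P : k[X] := (cyclotomicProd M).map (Int.castRingHom k)
  let Q : k[X] := X ^ μ - C (π x)
  have hP0 : P ≠ 0 := ((cyclotomicProd_monic M).map _).ne_zero
  let d : k[X] := EuclideanDomain.gcd P Q
  have hd0 : d ≠ 0 := fun h => hP0 (EuclideanDomain.gcd_eq_zero_iff.1 h).1
  have hdeg : d.natDegree ≤ j := by
    let K := AlgebraicClosure k
    have : CharP K p := charP_of_injective_algebraMap (algebraMap k K).injective p
    rw [← natDegree_map (algebraMap k K)]
    refine natDegree_le_of_dvd_of_dvd p hμ hM hsuff hj (x := algebraMap k K (π x)) ?_ ?_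
    · have := map_dvd (mapRingHom (algebraMap k K)) (EuclideanDomain.gcd_dvd_left P Q)
      rwa [coe_mapRingHom, Polynomial.map_map,
        RingHom.ext_int (RingHom.comp _ _) (Int.castRingHom K)] at this
    · have := map_dvd (mapRingHom (algebraMap k K)) (EuclideanDomain.gcd_dvd_right P Q)
      simpa [Q, Polynomial.map_map] using this
  -- divide a polynomial representing `y` by `d` over the residue field, and lift the result
  obtain ⟨f, rfl⟩ := AdjoinRoot.mk_surjective y
  let F : k[X] := f.map (Int.castRingHom k)
  obtain ⟨u, hu⟩ := map_surjective π hπ (EuclideanDomain.gcdA P Q * (F / d))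
  obtain ⟨v, hv⟩ := map_surjective π hπ (EuclideanDomain.gcdB P Q * (F / d))
  obtain ⟨r, hr, hrdeg⟩ : ∃ r : A[X], r.map π = F % d ∧ r.degree = (F % d).degree :=
    (exists_degree_eq_of_mem_lifts (f := π) ((lifts_iff_coeff_lifts _).2 fun n => hπ _))
  let f' : A[X] := f.map (Int.castRingHom A)
  let P' : A[X] := (cyclotomicProd M).map (Int.castRingHom A)
  have key : (f' - r - (P' * u + (X ^ μ - C x) * v)).map π = 0 := by
    have hf' : f'.map π = F := by
      rw [Polynomial.map_map, RingHom.ext_int (π.comp _) (Int.castRingHom k)]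
    have hP' : P'.map π = P := by
      rw [Polynomial.map_map, RingHom.ext_int (π.comp _) (Int.castRingHom k)]
    have hgcd : d = P * EuclideanDomain.gcdA P Q + Q * EuclideanDomain.gcdB P Q :=
      EuclideanDomain.gcd_eq_gcd_ab P Q
    have hdiv : d * (F / d) + F % d = F := EuclideanDomain.div_add_mod F d
    simp only [Polynomial.map_sub, Polynomial.map_add, Polynomial.map_mul, Polynomial.map_pow,
      map_X, map_C, hf', hP', hr, hu, hv]
    change F - F % d - (P * (_ * (F / d)) + Q * (_ * (F / d))) = 0
    linear_combination -hdiv + (F / d) * hgcd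
  have hval := hI0 _ key
  have hmap : ∀ g : ℤ[X], aeval t (g.map (Int.castRingHom A)) = AdjoinRoot.mk _ g := by
    intro g
    have := aeval_map_algebraMap A t g
    rw [← AdjoinRoot.aeval_eq]
    exact this
  have hx : aeval t (X ^ μ - C x : A[X]) = 0 := by
    rw [map_sub, map_pow, aeval_X, aeval_C, sub_eq_zero]
    rfl
  rw [map_sub, map_sub, map_add, map_mul, map_mul, hmap, hmap, AdjoinRoot.mk_self, hx, zero_mul,
    zero_mul, add_zero, sub_zero] at hval
  have hrN : aeval t r ∈ Submodule.span A (Set.range fun i : Fin j => t ^ (i : ℕ)) := by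
    rw [aeval_eq_sum_range]
    refine Submodule.sum_mem _ fun i hi => ?_
    by_cases hri : r.coeff i = 0
    · rw [hri, zero_smul]
      exact Submodule.zero_mem _
    · have hlt : i < j := by
        have h1 : (i : WithBot ℕ) ≤ r.degree := le_degree_of_ne_zero hri
        have h2 : r.degree < d.degree := hrdeg ▸ EuclideanDomain.mod_lt F hd0
        have h3 : d.degree ≤ (j : WithBot ℕ) := natDegree_le_iff_degree_le.1 hdeg
        exact_mod_cast (h1.trans_lt h2).trans_le h3
      exact Submodule.smul_mem _ _ (Submodule.subset_span ⟨⟨i, hlt⟩, rfl⟩)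
  have := Submodule.add_mem_sup hrN hval
  rwa [add_sub_cancel] at this

/-! ### Recognizing a standard decomposition -/

theorem coe_pow_restrict {V : Type*} [AddCommGroup V] {T : Module.End ℤ V} {B : Submodule ℤ V}
    (hB : ∀ y ∈ B, T y ∈ B) (n : ℕ) (y : B) :
    ((T.restrict hB ^ n) y : V) = (T ^ n) (y : V) := by
  induction n generalizing y with
  | zero => rfl
  | succ n ih =>
    rw [pow_succ, pow_succ, Module.End.mul_apply, ih, Module.End.mul_apply]
    rfl

theorem coe_aeval_restrict {V : Type*} [AddCommGroup V] {T : Module.End ℤ V}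
    {B : Submodule ℤ V} (hB : ∀ y ∈ B, T y ∈ B) (q : ℤ[X]) (y : B) :
    (aeval (T.restrict hB) q y : V) = aeval T q (y : V) := by
  simp only [aeval_eq_sum_range, LinearMap.sum_apply, LinearMap.smul_apply,
    Submodule.coe_sum, Submodule.coe_smul, coe_pow_restrict]

/-- A polynomial expression in `T` applied to `v` only depends on the residue class of the
polynomial modulo a monic `P` with `P(T) v = 0`. -/
theorem aeval_mem_span_of_monic {V : Type*} [AddCommGroup V] (T : Module.End ℤ V) {v : V}
    {P : ℤ[X]} (hP : P.Monic) (hv : aeval T P v = 0) (q : ℤ[X]) :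
    aeval T q v ∈ Submodule.span ℤ (Set.range fun k : Fin P.natDegree => (T ^ (k : ℕ)) v) := by
  have h : aeval T q v = aeval T (q %ₘ P) v := by
    conv_lhs => rw [← modByMonic_add_div q P]
    rw [map_add, mul_comm, map_mul, LinearMap.add_apply, Module.End.mul_apply, hv, map_zero,
      add_zero]
  rw [h, aeval_eq_sum_range, LinearMap.sum_apply]
  refine Submodule.sum_mem _ fun i _ => ?_
  by_cases hi : (q %ₘ P).coeff i = 0
  · rw [hi, zero_smul, LinearMap.zero_apply]
    exact Submodule.zero_mem _
  · have hlt : i < P.natDegree := by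
      by_contra! hle
      refine hi (coeff_eq_zero_of_degree_lt ((degree_modByMonic_lt q hP).trans_le ?_))
      rw [degree_eq_natDegree hP.ne_zero]
      exact_mod_cast hle
    exact Submodule.smul_mem _ _ (Submodule.subset_span ⟨⟨i, hlt⟩, rfl⟩)

/-- A monic polynomial of degree `rank V` which annihilates a cyclic vector is the
characteristic polynomial. -/
theorem charpoly_eq_of_linearIndependent {V : Type*} [AddCommGroup V] [Module.Free ℤ V]
    [Module.Finite ℤ V] {T : Module.End ℤ V} {v : V} {P : ℤ[X]} (hP : P.Monic)
    (hdeg : Module.finrank ℤ V = P.natDegree) (hv : aeval T P v = 0)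
    (hli : LinearIndependent ℤ fun k : Fin P.natDegree => (T ^ (k : ℕ)) v) :
    T.charpoly = P := by
  have hD : aeval T (T.charpoly - P) v = 0 := by
    rw [map_sub, LinearMap.sub_apply, hv, LinearMap.aeval_self_charpoly, LinearMap.zero_apply,
      sub_zero]
  have hlt : (T.charpoly - P).degree < (P.natDegree : WithBot ℕ) := by
    rw [← hdeg, ← T.charpoly_natDegree, ← degree_eq_natDegree T.charpoly_monic.ne_zero]
    refine degree_sub_lt_left ?_ T.charpoly_monic.ne_zero ?_
    · rw [degree_eq_natDegree T.charpoly_monic.ne_zero, degree_eq_natDegree hP.ne_zero,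
        T.charpoly_natDegree, hdeg]
    · rw [T.charpoly_monic.leadingCoeff, hP.leadingCoeff]
  by_contra hne
  rw [aeval_eq_sum_range' ((natDegree_lt_iff_degree_lt (sub_ne_zero.2 hne)).2 hlt),
    LinearMap.sum_apply, Finset.sum_range] at hD
  have hc := Fintype.linearIndependent_iff.1 hli _ hD
  refine hne (sub_eq_zero.1 (Polynomial.ext fun n => ?_))
  rw [coeff_zero]
  by_cases hn : n < P.natDegree
  · exact hc ⟨n, hn⟩
  · exact coeff_eq_zero_of_degree_lt (hlt.trans_le (by exact_mod_cast not_lt.1 hn))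

theorem isCompanionBlock_of_finrank_eq {V : Type*} [AddCommGroup V] [Module.Free ℤ V]
    [Module.Finite ℤ V] {T : Module.End ℤ V} {n : ℕ} (hn : Module.finrank ℤ V = n) (h1 : 1 ≤ n)
    {v : V} (hli : LinearIndependent ℤ fun k : Fin n => (T ^ (k : ℕ)) v)
    (hspan : Submodule.span ℤ (Set.range fun k : Fin n => (T ^ (k : ℕ)) v) = ⊤) :
    IsCompanionBlock T := by
  subst hn
  exact ⟨h1, v, hli, hspan⟩

/-- The invariant sublattice generated by a vector whose powers under `T`, up to the degree of an
annihilating monic polynomial `P`, are independent is a companion block with characteristic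
polynomial `P`. -/
theorem isCompanionBlock_restrict_and_charpoly_eq {V : Type*} [AddCommGroup V] [Module.Free ℤ V]
    [Module.Finite ℤ V] {T : Module.End ℤ V} {v : V} {P : ℤ[X]} (hP : P.Monic)
    (hdeg : 1 ≤ P.natDegree) (hv : aeval T P v = 0)
    (hli : LinearIndependent ℤ fun k : Fin P.natDegree => (T ^ (k : ℕ)) v) {B : Submodule ℤ V}
    (hspan : B = Submodule.span ℤ (Set.range fun k : Fin P.natDegree => (T ^ (k : ℕ)) v))
    (hB : ∀ y ∈ B, T y ∈ B) :
    IsCompanionBlock (T.restrict hB) ∧ (T.restrict hB).charpoly = P := by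
  have hfin : Module.finrank ℤ B = P.natDegree := by
    rw [hspan, finrank_span_eq_card hli, Fintype.card_fin]
  have hvB : v ∈ B := hspan ▸ Submodule.subset_span ⟨⟨0, hdeg⟩, rfl⟩
  have hcoe : (fun k : Fin P.natDegree => B.subtype ((T.restrict hB ^ (k : ℕ)) ⟨v, hvB⟩)) =
      fun k : Fin P.natDegree => (T ^ (k : ℕ)) v :=
    funext fun k => coe_pow_restrict hB _ _
  have hli' : LinearIndependent ℤ fun k : Fin P.natDegree =>
      (T.restrict hB ^ (k : ℕ)) ⟨v, hvB⟩ :=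
    LinearIndependent.of_comp B.subtype (by rw [Function.comp_def, hcoe]; exact hli)
  refine ⟨isCompanionBlock_of_finrank_eq hfin hdeg hli' ?_,
    charpoly_eq_of_linearIndependent hP hfin (Subtype.ext ?_) hli'⟩
  · refine Submodule.map_injective_of_injective B.injective_subtype ?_
    rw [Submodule.map_span, Submodule.map_subtype_top, ← Set.range_comp, Function.comp_def, hcoe,
      ← hspan]
  · rw [coe_aeval_restrict]
    exact hv

/-- An automorphism of finite order admits a standard decomposition if there are vectors `v i`,
annihilated by monic polynomials `P i` of total degree `rank V` with the right divisibilities,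
which generate the lattice as a module over the polynomials in the automorphism. -/
theorem hasStandardOrlikDecomposition_of_generators {V : Type*} [AddCommGroup V]
    [Module.Free ℤ V] [Module.Finite ℤ V] {T : Module.End ℤ V} (hT : IsOfFinOrder T) {r : ℕ}
    (v : Fin r → V) (P : Fin r → ℤ[X]) (hP : ∀ i, (P i).Monic) (hdeg : ∀ i, 1 ≤ (P i).natDegree)
    (hv : ∀ i, aeval T (P i) (v i) = 0)
    (hgen : ∀ y, ∃ q : Fin r → ℤ[X], ∑ i, aeval T (q i) (v i) = y)
    (hrank : ∑ i, (P i).natDegree = Module.finrank ℤ V)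
    (hdvd : ∀ i j, i ≤ j → P j ∣ P i) : HasStandardOrlikDecomposition T := by
  let w : (Σ i, Fin (P i).natDegree) → V := fun s => (T ^ (s.2 : ℕ)) (v s.1)
  let B : Fin r → Submodule ℤ V := fun i =>
    Submodule.span ℤ (Set.range fun k : Fin (P i).natDegree => (T ^ (k : ℕ)) (v i))
  have hmemB : ∀ i q, aeval T q (v i) ∈ B i := fun i q =>
    aeval_mem_span_of_monic T (hP i) (hv i) q
  have hBimage : ∀ i, B i = Submodule.span ℤ (w '' {s | s.1 = i}) := by
    intro i
    refine congrArg (Submodule.span ℤ) (Set.ext fun y => ⟨?_, ?_⟩)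
    · rintro ⟨k, rfl⟩
      exact ⟨⟨i, k⟩, rfl, rfl⟩
    · rintro ⟨⟨i', k⟩, rfl, rfl⟩
      exact ⟨k, rfl⟩
  have hwspan : ⊤ ≤ Submodule.span ℤ (Set.range w) := by
    intro y _
    obtain ⟨q, rfl⟩ := hgen y
    refine Submodule.sum_mem _ fun i _ => ?_
    have h := hmemB i (q i)
    rw [hBimage] at h
    exact Submodule.span_mono (Set.image_subset_range _ _) h
  have hwli : LinearIndependent ℤ w := by
    refine linearIndependent_of_top_le_span_of_card_eq_finrank hwspan ?_
    simpa using hrank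
  have hB : ∀ i, ∀ y ∈ B i, T y ∈ B i := by
    intro i y hy
    refine Submodule.span_le (p := (B i).comap T).2 ?_ hy
    rintro _ ⟨k, rfl⟩
    have := hmemB i (X ^ ((k : ℕ) + 1))
    rwa [map_pow, aeval_X, pow_succ', Module.End.mul_apply] at this
  have hli : ∀ i, LinearIndependent ℤ fun k : Fin (P i).natDegree => (T ^ (k : ℕ)) (v i) :=
    fun i => hwli.comp (Sigma.mk i) sigma_mk_injective
  have hblock := fun i => isCompanionBlock_restrict_and_charpoly_eq (hP i) (hdeg i) (hv i) (hli i)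
    (B := B i) rfl (hB i)
  refine ⟨r, B, hB, ?_, fun i => ⟨(hblock i).1, ?_⟩, fun i j hij => ?_⟩
  · rw [DirectSum.isInternal_submodule_iff_iSupIndep_and_iSup_eq_top]
    refine ⟨fun i => ?_, top_le_iff.1 fun y _ => ?_⟩
    · have hdisj : Disjoint {s : Σ i, Fin (P i).natDegree | s.1 = i} {s | s.1 ≠ i} :=
        Set.disjoint_left.2 fun s hs hs' => hs' hs
      refine (hwli.disjoint_span_image hdisj).mono (hBimage i).le ?_
      refine iSup₂_le fun j hj => ?_
      rw [hBimage]
      refine Submodule.span_mono (Set.image_mono fun s hs => ?_)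
      exact fun hs' : s.1 = i => hj ((show s.1 = j from hs).symm.trans hs')
    · obtain ⟨q, rfl⟩ := hgen y
      exact Submodule.sum_mem _ fun i _ => Submodule.mem_iSup_of_mem i (hmemB i (q i))
  · obtain ⟨n, hn, h⟩ := isOfFinOrder_iff_pow_eq_one.1 hT
    refine isOfFinOrder_iff_pow_eq_one.2 ⟨n, hn, LinearMap.ext fun y => Subtype.ext ?_⟩
    rw [coe_pow_restrict, h]
    rfl
  · rw [(hblock i).2, (hblock j).2]
    exact hdvd i j hij

/-! ### Generators of the blocks -/

theorem aeval_monodromy_pow (M : Finset ℕ) (μ : ℕ) (q f : ℤ[X]) :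
    aeval (monodromy M ^ μ) q (AdjoinRoot.mk (cyclotomicProd M) f) =
      AdjoinRoot.mk (cyclotomicProd M) (expand ℤ μ q * f) := by
  have h : monodromy M ^ μ =
      Algebra.lmul ℤ (Or M) (AdjoinRoot.root (cyclotomicProd M) ^ μ) := by
    rw [map_pow]
    rfl
  rw [h, aeval_algHom_apply, map_mul, ← AdjoinRoot.aeval_eq (expand ℤ μ q), expand_aeval]
  rfl

theorem isOfFinOrder_monodromy {M : Finset ℕ} (hM : ∀ m ∈ M, 0 < m) :
    IsOfFinOrder (monodromy M) := by
  refine isOfFinOrder_iff_pow_eq_one.2 ⟨∏ m ∈ M, m, Finset.prod_pos hM, LinearMap.ext fun y => ?_⟩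
  obtain ⟨f, rfl⟩ := AdjoinRoot.mk_surjective y
  have h := aeval_monodromy_pow M (∏ m ∈ M, m) X f
  rw [aeval_X, expand_X] at h
  rw [h, Module.End.one_apply, AdjoinRoot.mk_eq_mk, ← sub_one_mul]
  exact dvd_mul_of_dvd_left cyclotomicProd_dvd_X_pow_sub_one f

theorem mem_powerSubring {M : Finset ℕ} {μ : ℕ} (y : powerSubring M μ) :
    ∃ q : ℤ[X], AdjoinRoot.mk (cyclotomicProd M) (expand ℤ μ q) = y := by
  obtain ⟨y, hy⟩ := y
  rw [powerSubring, Algebra.adjoin_singleton_eq_range_aeval] at hy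
  obtain ⟨q, hq⟩ := hy
  refine ⟨q, ?_⟩
  rw [← AdjoinRoot.aeval_eq, expand_aeval]
  exact hq

/-- The elements of `M` for which the multiplicity of `γ_μ m` is at most `j`. -/
def lowPart (M : Finset ℕ) (μ j : ℕ) : Finset ℕ :=
  M.filter fun m => fiberRank M μ (gammaMap μ m) ≤ j

theorem fiberRank_lowPart_le {M : Finset ℕ} {μ j m : ℕ} (hm : m ∈ lowPart M μ j) :
    fiberRank (lowPart M μ j) μ (gammaMap μ m) ≤ j :=
  (Finset.sum_le_sum_of_subset (Finset.filter_subset_filter _ (Finset.filter_subset _ _))).trans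
    (Finset.mem_filter.1 hm).2

/-- Sufficiency passes to `lowPart`, since it is a union of fibers of `γ_μ` in `M`. -/
theorem isSdiObSufficient_lowPart {M : Finset ℕ} {μ : ℕ} (hsuff : IsSdiObSufficient M μ) (j : ℕ) :
    IsSdiObSufficient (lowPart M μ j) μ := by
  rintro p hp a b ⟨hab, ⟨m, hm, rfl⟩, ⟨n, hn, rfl⟩⟩
  obtain ⟨hm, hmj⟩ := Finset.mem_filter.1 (Finset.mem_coe.1 hm)
  obtain ⟨hn, hnj⟩ := Finset.mem_filter.1 (Finset.mem_coe.1 hn)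
  have hsub : ∀ l ∈ lowPart M μ j, l ∈ M := fun l hl => (Finset.mem_filter.1 hl).1
  have hma : ∀ l ∈ M, l ∈ gammaFiber μ (gammaMap μ m) → l ∈ lowPart M μ j := fun l hl h =>
    Finset.mem_filter.2 ⟨hl, by rw [h.2]; exact hmj⟩
  have hnb : ∀ l ∈ M, l ∈ gammaFiber μ (gammaMap μ n) → l ∈ lowPart M μ j := fun l hl h =>
    Finset.mem_filter.2 ⟨hl, by rw [h.2]; exact hnj⟩
  refine (hsuff p hp _ _ ⟨hab, ⟨m, hm, rfl⟩, ⟨n, hn, rfl⟩⟩).imp ?_ ?_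
  · rintro h e ⟨he, ⟨h1, h1M⟩, h2⟩
    have := h ⟨he, ⟨h1, hsub _ h1M⟩, h2⟩
    exact ⟨he, h1M, hnb _ this.2.2 h2⟩
  · rintro h e ⟨he, h1, h2, h2M⟩
    have := h ⟨he, h1, h2, hsub _ h2M⟩
    exact ⟨he, hma _ this.2.1 h1, h2M⟩

/-- There is a polynomial in `X ^ μ` and `X` which is monic of degree `j` in `X` and is divisible
by all `Φ_m` such that the multiplicity of `γ_μ m` is at most `j`. -/
theorem exists_block_generator {μ : ℕ} (hμ : 0 < μ) {M : Finset ℕ} (hM : ∀ m ∈ M, 0 < m)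
    (hsuff : IsSdiObSufficient M μ) (j : ℕ) :
    ∃ a : Fin j → ℤ[X],
      cyclotomicProd (lowPart M μ j) ∣ X ^ j - ∑ i, expand ℤ μ (a i) * X ^ (i : ℕ) := by
  have htop := span_root_pow_eq_top hμ (M := lowPart M μ j)
    (fun m hm => hM m (Finset.mem_filter.1 hm).1) (isSdiObSufficient_lowPart hsuff j)
    fun m hm => fiberRank_lowPart_le hm
  have hmem : AdjoinRoot.root (cyclotomicProd (lowPart M μ j)) ^ j ∈
      (⊤ : Submodule (powerSubring (lowPart M μ j) μ) (Or (lowPart M μ j))) := trivial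
  rw [← htop, Submodule.mem_span_range_iff_exists_fun] at hmem
  obtain ⟨c, hc⟩ := hmem
  choose a ha using fun i => mem_powerSubring (c i)
  refine ⟨a, ?_⟩
  rw [← AdjoinRoot.mk_eq_mk, map_sum, map_pow, AdjoinRoot.mk_X, ← hc]
  refine Finset.sum_congr rfl fun i _ => ?_
  rw [map_mul, map_pow, AdjoinRoot.mk_X, ha]
  rfl

/-- The orders of the eigenvalues of multiplicity greater than `j`: the eigenvalues of the
block with index `j`, counted from `0`. -/
def blockOrders (M : Finset ℕ) (μ j : ℕ) : Finset ℕ :=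
  (M.image (gammaMap μ)).filter fun n => j < fiberRank M μ n

theorem cyclotomicProd_dvd_mul {μ : ℕ} (hμ : 0 < μ) {M : Finset ℕ} (hM : ∀ m ∈ M, 0 < m) {j : ℕ}
    {g : ℤ[X]} (hg : cyclotomicProd (lowPart M μ j) ∣ g) :
    cyclotomicProd M ∣ expand ℤ μ (cyclotomicProd (blockOrders M μ j)) * g := by
  have hsplit : cyclotomicProd M = cyclotomicProd (lowPart M μ j) *
      cyclotomicProd (M.filter fun m => ¬ fiberRank M μ (gammaMap μ m) ≤ j) :=
    (Finset.prod_filter_mul_prod_filter_not M _ _).symm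
  rw [hsplit, mul_comm]
  refine mul_dvd_mul (cyclotomicProd_dvd_expand hμ (fun m hm => hM m (Finset.mem_filter.1 hm).1)
    fun m hm => ?_) hg
  obtain ⟨hm, hmj⟩ := Finset.mem_filter.1 hm
  exact Finset.mem_filter.2 ⟨Finset.mem_image_of_mem _ hm, not_le.1 hmj⟩

theorem sum_natDegree_blockOrders {M : Finset ℕ} {μ r : ℕ}
    (hr : ∀ n ∈ M.image (gammaMap μ), fiberRank M μ n ≤ r) :
    ∑ j : Fin r, (cyclotomicProd (blockOrders M μ j)).natDegree = ∑ m ∈ M, m.totient := by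
  simp_rw [natDegree_cyclotomicProd, blockOrders, Finset.sum_filter]
  rw [Finset.sum_comm, ← sum_fiberRank_mul_totient M μ]
  refine Finset.sum_congr rfl fun n hn => ?_
  rw [Fin.sum_univ_eq_sum_range (fun j => if j < fiberRank M μ n then n.totient else 0),
    ← Finset.sum_filter, Finset.sum_const, smul_eq_mul]
  congr 1
  have : (Finset.range r).filter (fun j => j < fiberRank M μ n) =
      Finset.range (fiberRank M μ n) := by
    ext j
    have := hr n hn
    simp only [Finset.mem_filter, Finset.mem_range]
    omega
  rw [this, Finset.card_range]

theorem finrank_or (M : Finset ℕ) : Module.finrank ℤ (Or M) = ∑ m ∈ M, m.totient := by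
  rw [(AdjoinRoot.powerBasis' (cyclotomicProd_monic M)).finrank, AdjoinRoot.powerBasis'_dim,
    natDegree_cyclotomicProd]

end

end OrlikBlocks

open Polynomial OrlikBlocks in
theorem theorem6p2 (M : Finset ℕ) (hM : M.Nonempty) (hMpos : ∀ m ∈ M, 0 < m)
    (μ : ℕ) (hμ : 0 < μ) (hsuff : OrlikBlocks.IsSdiObSufficient M μ) :
    OrlikBlocks.HasStandardOrlikDecomposition (OrlikBlocks.monodromy M ^ μ) := by
  classical
  obtain ⟨n₀, hn₀, hmax⟩ := (M.image (gammaMap μ)).exists_max_image (fiberRank M μ) (hM.image _)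
  set r := fiberRank M μ n₀
  choose a ha using exists_block_generator hμ hMpos hsuff
  let g : ℕ → ℤ[X] := fun j => X ^ j - ∑ i, expand ℤ μ (a j i) * X ^ (i : ℕ)
  have hn₀pos : 0 < n₀ := by
    obtain ⟨m, hm, rfl⟩ := Finset.mem_image.1 hn₀
    exact gammaMap_pos (hMpos m hm)
  refine hasStandardOrlikDecomposition_of_generators
    ((isOfFinOrder_monodromy hMpos).pow) (r := r)
    (fun j => AdjoinRoot.mk (cyclotomicProd M) (g j))
    (fun j => cyclotomicProd (blockOrders M μ j)) (fun j => cyclotomicProd_monic _)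
    (fun j => ?_) (fun j => ?_) (fun y => ?_) ?_ (fun i j hij => ?_)
  · rw [natDegree_cyclotomicProd]
    exact (Nat.totient_pos.2 hn₀pos).trans_le (Finset.single_le_sum (f := Nat.totient)
      (fun _ _ => Nat.zero_le _) (Finset.mem_filter.2 ⟨hn₀, j.2⟩))
  · rw [aeval_monodromy_pow, AdjoinRoot.mk_eq_zero]
    exact cyclotomicProd_dvd_mul hμ hMpos (ha j)
  · -- the generators are obtained from the powers of `t` by a unitriangular substitution
    have hpow : ∀ i < r, AdjoinRoot.root (cyclotomicProd M) ^ i ∈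
        Submodule.span (powerSubring M μ)
          (Set.range fun j : Fin r => AdjoinRoot.mk (cyclotomicProd M) (g j)) := by
      intro i
      induction i using Nat.strong_induction_on with
      | _ i ih =>
        intro hi
        have hX : (X : ℤ[X]) ^ i = g i + ∑ l, expand ℤ μ (a i l) * X ^ (l : ℕ) :=
          (sub_add_cancel _ _).symm
        rw [← AdjoinRoot.mk_X, ← map_pow, hX, map_add, map_sum]
        refine Submodule.add_mem _ (Submodule.subset_span ⟨⟨i, hi⟩, rfl⟩)
          (Submodule.sum_mem _ fun l _ => ?_)
        rw [map_mul, map_pow, AdjoinRoot.mk_X, ← AdjoinRoot.aeval_eq, expand_aeval]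
        exact Submodule.smul_mem _
          (⟨_, aeval_mem_adjoin_singleton ℤ _⟩ : powerSubring M μ) (ih l l.2 (l.2.trans hi))
    have hy : y ∈ Submodule.span (powerSubring M μ)
        (Set.range fun j : Fin r => AdjoinRoot.mk (cyclotomicProd M) (g j)) := by
      refine Submodule.span_le.2 ?_ ((span_root_pow_eq_top hμ hMpos hsuff (j := r) fun m hm =>
        hmax _ (Finset.mem_image_of_mem _ hm)).ge (Submodule.mem_top (x := y)))
      rintro _ ⟨i, rfl⟩
      exact hpow i i.2
    obtain ⟨c, hc⟩ := (Submodule.mem_span_range_iff_exists_fun _).1 hy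
    choose q hq using fun i => mem_powerSubring (c i)
    refine ⟨q, ?_⟩
    rw [← hc]
    refine Finset.sum_congr rfl fun i _ => ?_
    rw [aeval_monodromy_pow, map_mul, hq]
    rfl
  · rw [finrank_or, sum_natDegree_blockOrders hmax]
  · refine Finset.prod_dvd_prod_of_subset _ _ _ fun n hn => ?_
    obtain ⟨hn, hjn⟩ := Finset.mem_filter.1 hn
    exact Finset.mem_filter.2 ⟨hn, lt_of_le_of_lt (by exact_mod_cast hij) hjn⟩
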